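/- Let $K$ be a field and $S=K[x_1,\dots,x_n]$ with graded maximal ideal $\mathfrak m=(x_1,\dots,x_n)$. For a non-empty subset $F\subseteq\{1,\dots,n\}$ let $\mathfrak p_F=(x_i : i\in F)\subset S$; the ideals of this form are called monomial prime ideals. For an ideal $I\subsetneq S$ let $\operatorname{depth} S/I$ be the supremum of the lengths of $S/I$-regular sequences with entries in $\mathfrak m$, and let $\operatorname{mdepth} S/I=\min\{\dim S/\mathfrak p : \mathfrak p\in\operatorname{Ass}(S/I)\}$; one says that $I$ has maximal depth if $\operatorname{depth} S/I=\operatorname{mdepth} S/I$. Let $r\ge 1$, let $F_1,\dots,F_r$ be non-empty, pairwise disjoint subsets of $\{1,\dots,n\}$, and let $I=\mathfrak p_{F_1}\cap\dots\cap\mathfrak p_{F_r}$. Then $I$ has maximal depth if and only if there are $s\ge 1$ and non-empty subsets $G_1,\dots,G_s\subseteq\{1,\dots,n\}$ (not assumed to be disjoint or distinct) such that $I=\mathfrak p_{G_1}\cdots\mathfrak p_{G_s}$ and at most one of the factors $\mathfrak p_{G_1},\dots,\mathfrak p_{G_s}$ is not a principal ideal. -/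

import Mathlib

noncomputable section

/-- The depth of an `R`-module `M` with respect to an ideal `J`: the supremum of the lengths of
`M`-regular sequences with entries in `J`. For a standard graded algebra `R` with graded maximal
ideal `J` and a finitely generated module `M`, this is the usual `depth M`. -/
def moduleDepth {R : Type*} [CommRing R] (J : Ideal R)
    (M : Type*) [AddCommGroup M] [Module R M] : ℕ∞ :=
  ⨆ rs ∈ {rs : List R | (∀ x ∈ rs, x ∈ J) ∧ RingTheory.Sequence.IsRegular M rs},
    (rs.length : ℕ∞)

/-- `mdepth M`: the minimum of `dim R/p` over the associated primes `p` of `M`. -/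
def moduleMDepth (R : Type*) [CommRing R]
    (M : Type*) [AddCommGroup M] [Module R M] : WithBot ℕ∞ :=
  ⨅ p ∈ associatedPrimes R M, ringKrullDim (R ⧸ p)

/-- An ideal `I` of `S = K[x_1, …, x_n]` has maximal depth if `depth S/I = mdepth S/I`,
where the depth is taken with respect to the graded maximal ideal `(x_1, …, x_n)`. -/
def HasMaximalDepth {K : Type*} [Field K] {n : ℕ} (I : Ideal (MvPolynomial (Fin n) K)) : Prop :=
  (moduleDepth (MvPolynomial.idealOfVars (Fin n) K) (MvPolynomial (Fin n) K ⧸ I) : WithBot ℕ∞) =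
    moduleMDepth (MvPolynomial (Fin n) K) (MvPolynomial (Fin n) K ⧸ I)

/-- The ideal generated by the variables `x_i` with `i ∈ F`; for non-empty `F` these are the
monomial prime ideals of `K[x_1, …, x_n]`. -/
def monomialPrime (K : Type*) [Field K] {n : ℕ} (F : Finset (Fin n)) :
    Ideal (MvPolynomial (Fin n) K) :=
  Ideal.span (MvPolynomial.X '' (F : Set (Fin n)))

end

/-!
By Rees' theorem `depth S/I` is the least `i` with `Ext^i(S/𝔪, S/I) ≠ 0`, so it can be computed
from long exact sequences. For an ideal `J` generated by monomials in variables outside `F`, the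
variables in `F` form a regular sequence on `S/J`, and `J ∩ 𝔭_F = J 𝔭_F`. Hence
`depth S/(J + 𝔭_F) = depth S/J - |F|`, and the Mayer–Vietoris sequence
`0 → S/(J ∩ 𝔭_F) → S/J × S/𝔭_F → S/(J + 𝔭_F) → 0` gives, by induction on `r`,
`depth S/I = n - ∑ |F_i| + r - 1`. The associated primes of `S/I` are the `𝔭_{F_i}`, so
`mdepth S/I = n - max |F_i|`. The two numbers agree iff at most one `F_i` has more than one
element, in which case `I = ∏ 𝔭_{F_i}` is a factorization as required. Conversely, in any
factorization of `I` into primes each minimal prime `𝔭_{F_i}` of `I` occurs as a factor, and the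
principal monomial primes are those generated by a single variable.
-/

section MayerVietoris

variable {R M : Type*} [CommRing R] [AddCommGroup M] [Module R M] (P Q : Submodule R M)

/-- The first map of the Mayer–Vietoris sequence `0 → M/(P ⊓ Q) → M/P × M/Q → M/(P ⊔ Q) → 0`. -/
def quotientInfToProd : (M ⧸ P ⊓ Q) →ₗ[R] (M ⧸ P) × (M ⧸ Q) :=
  (Submodule.factor inf_le_left).prod (Submodule.factor inf_le_right)

/-- The second map of the Mayer–Vietoris sequence `0 → M/(P ⊓ Q) → M/P × M/Q → M/(P ⊔ Q) → 0`,
the difference of the two projections. -/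
def prodToQuotientSup : (M ⧸ P) × (M ⧸ Q) →ₗ[R] M ⧸ P ⊔ Q :=
  (Submodule.factor le_sup_left).coprod (-Submodule.factor le_sup_right)

theorem quotientInfToProd_injective : Function.Injective (quotientInfToProd P Q) := by
  refine (injective_iff_map_eq_zero _).2 fun x hx => ?_
  induction x using Submodule.Quotient.induction_on with | _ x => ?_
  simpa [quotientInfToProd] using hx

theorem prodToQuotientSup_surjective : Function.Surjective (prodToQuotientSup P Q) := fun x =>
  let ⟨y, hy⟩ := Submodule.factor_surjective (le_sup_left : P ≤ P ⊔ Q) x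
  ⟨(y, 0), by simp [prodToQuotientSup, hy]⟩

theorem exact_quotientInfToProd_prodToQuotientSup :
    Function.Exact (quotientInfToProd P Q) (prodToQuotientSup P Q) := by
  refine LinearMap.exact_of_comp_eq_zero_of_ker_le_range ?_ ?_
  · ext x
    simp [prodToQuotientSup, quotientInfToProd]
  · rintro ⟨x, y⟩ hxy
    induction x using Submodule.Quotient.induction_on with | _ x => ?_
    induction y using Submodule.Quotient.induction_on with | _ y => ?_
    have sub_mem : x - y ∈ P ⊔ Q := by
      rw [← Submodule.Quotient.mk_eq_zero, Submodule.Quotient.mk_sub, sub_eq_add_neg]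
      exact hxy
    obtain ⟨a, ha, b, hb, hab⟩ := Submodule.mem_sup.1 sub_mem
    have sub_a_sub_y : x - a - y = b := by rw [sub_right_comm, ← hab, add_sub_cancel_left]
    refine ⟨Submodule.Quotient.mk (x - a), Prod.ext ((Submodule.Quotient.eq P).2 ?_)
      ((Submodule.Quotient.eq Q).2 ?_)⟩
    · simpa using ha
    · exact sub_a_sub_y.symm ▸ hb

end MayerVietoris

section Ext

open CategoryTheory Abelian

universe u v

variable {R : Type u} [CommRing R] [Small.{v} R]

section ShortExact

variable {S : ShortComplex (ModuleCat.{v} R)} (hS : S.ShortExact) (N : ModuleCat.{v} R)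
include hS

theorem subsingleton_ext_middle_of_shortExact {i : ℕ} (h₁ : Subsingleton (Ext N S.X₁ i))
    (h₃ : Subsingleton (Ext N S.X₃ i)) : Subsingleton (Ext N S.X₂ i) := by
  refine subsingleton_of_forall_eq 0 fun x => ?_
  obtain ⟨y, rfl⟩ := Ext.covariant_sequence_exact₂ N hS x (Subsingleton.elim _ _)
  rw [Subsingleton.elim y 0, Ext.zero_comp]

theorem subsingleton_ext_right_of_shortExact {i : ℕ} (h₂ : Subsingleton (Ext N S.X₂ i))
    (h₁ : Subsingleton (Ext N S.X₁ (i + 1))) : Subsingleton (Ext N S.X₃ i) := by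
  refine subsingleton_of_forall_eq 0 fun x => ?_
  obtain ⟨y, rfl⟩ := Ext.covariant_sequence_exact₃ N hS x rfl (Subsingleton.elim _ _)
  rw [Subsingleton.elim y 0, Ext.zero_comp]

theorem subsingleton_ext_zero_left_of_shortExact [Subsingleton (Ext N S.X₂ 0)] :
    Subsingleton (Ext N S.X₁ 0) := by
  have := hS.mono_f
  exact (Ext.postcomp_mk₀_injective_of_mono N S.f).subsingleton

theorem subsingleton_ext_succ_left_of_shortExact {i : ℕ} (h₃ : Subsingleton (Ext N S.X₃ i))
    (h₂ : Subsingleton (Ext N S.X₂ (i + 1))) : Subsingleton (Ext N S.X₁ (i + 1)) := by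
  refine subsingleton_of_forall_eq 0 fun x => ?_
  obtain ⟨y, rfl⟩ := Ext.covariant_sequence_exact₁ N hS x (Subsingleton.elim _ _) rfl
  rw [Subsingleton.elim y 0, Ext.zero_comp]

end ShortExact

variable {N M M' : Type v} [AddCommGroup N] [Module R N] [AddCommGroup M] [Module R M]
  [AddCommGroup M'] [Module R M']

theorem subsingleton_ext_congr (N : ModuleCat.{v} R) (e : M ≃ₗ[R] M') (i : ℕ) :
    Subsingleton (Ext N (ModuleCat.of R M) i) ↔ Subsingleton (Ext N (ModuleCat.of R M') i) :=
  ((extFunctorObj N i).mapIso e.toModuleIso).addCommGroupIsoToAddEquiv.toEquiv.subsingleton_congr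

theorem subsingleton_ext_prod (N : ModuleCat.{v} R) {i : ℕ}
    (h : Subsingleton (Ext N (ModuleCat.of R M) i))
    (h' : Subsingleton (Ext N (ModuleCat.of R M') i)) :
    Subsingleton (Ext N (ModuleCat.of R (M × M')) i) :=
  subsingleton_ext_middle_of_shortExact
    (ModuleCat.shortComplex_shortExact
      (ModuleCat.shortComplexOfCompEqZero (LinearMap.inl R M M') (LinearMap.snd R M M')
        (LinearMap.snd_comp_inl R M M'))
      Function.Exact.inl_snd LinearMap.inl_injective LinearMap.snd_surjective) N h h'

section Regular

variable {r : R} (hN : r ∈ Module.annihilator R N) (hM : IsSMulRegular M r)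
include hN hM

theorem subsingleton_ext_zero_of_isSMulRegular :
    Subsingleton (Ext (ModuleCat.of R N) (ModuleCat.of R M) 0) := by
  have := (IsSMulRegular.smulShortComplex_shortExact (M := ModuleCat.of R M) hM).mono_f
  refine subsingleton_of_forall_eq 0 fun x => ?_
  refine Ext.postcomp_mk₀_injective_of_mono _ ((ModuleCat.of R M).smulShortComplex r).f ?_
  exact (DFunLike.congr_fun (congrArg AddCommGrpCat.Hom.hom
    (Ext.postcomp_smul_id_eq_zero_of_mem_annihilator hN 0)) x).trans (map_zero _).symm

theorem subsingleton_ext_quotSMulTop_iff (i : ℕ) :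
    Subsingleton (Ext (ModuleCat.of R N) (ModuleCat.of R (QuotSMulTop r M)) i) ↔
      Subsingleton (Ext (ModuleCat.of R N) (ModuleCat.of R M) i) ∧
        Subsingleton (Ext (ModuleCat.of R N) (ModuleCat.of R M) (i + 1)) := by
  have hS := IsSMulRegular.smulShortComplex_shortExact (M := ModuleCat.of R M) hM
  have multiplication_eq_zero (j : ℕ) (x : Ext (ModuleCat.of R N) (ModuleCat.of R M) j) :
      x.comp (Ext.mk₀ ((ModuleCat.of R M).smulShortComplex r).f) (add_zero j) = 0 :=
    DFunLike.congr_fun (congrArg AddCommGrpCat.Hom.hom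
      (Ext.postcomp_smul_id_eq_zero_of_mem_annihilator hN j)) x
  refine ⟨fun hQ => ⟨?_, ?_⟩, fun h => subsingleton_ext_right_of_shortExact hS _ h.1 h.2⟩
  · refine subsingleton_of_forall_eq 0 fun x => ?_
    obtain ⟨y, rfl⟩ := Ext.covariant_sequence_exact₂ _ hS x (@Subsingleton.elim _ hQ _ _)
    exact multiplication_eq_zero i y
  · refine subsingleton_of_forall_eq 0 fun x => ?_
    obtain ⟨y, rfl⟩ := Ext.covariant_sequence_exact₁ _ hS x (multiplication_eq_zero (i + 1) x) rfl
    rw [@Subsingleton.elim _ hQ y 0]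
    exact Ext.zero_comp ..

end Regular

section Grade

variable (R) in
/-- The grade of `N` on `M` is `d`: the first nonzero group among the `Ext^i(N, M)` occurs at
`i = d`. For finite modules over a Noetherian ring and `N = R ⧸ J`, Rees' theorem identifies this
number with the length of the maximal `M`-regular sequences in `J`. -/
def IsGrade (N M : Type v) [AddCommGroup N] [Module R N] [AddCommGroup M] [Module R M]
    (d : ℕ) : Prop :=
  (∀ i < d, Subsingleton (Ext (ModuleCat.of R N) (ModuleCat.of R M) i)) ∧
    ¬ Subsingleton (Ext (ModuleCat.of R N) (ModuleCat.of R M) d)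

variable {d : ℕ}

theorem isGrade_congr (e : M ≃ₗ[R] M') : IsGrade R N M d ↔ IsGrade R N M' d := by
  simp only [IsGrade, subsingleton_ext_congr _ e]

theorem isGrade_zero_iff : IsGrade R N M 0 ↔ Nontrivial (N →ₗ[R] M) := by
  rw [IsGrade, ← not_subsingleton_iff_nontrivial]
  simpa only [Nat.not_lt_zero, IsEmpty.forall_iff, implies_true, true_and] using
    (Ext.addEquiv₀.trans ModuleCat.homAddEquiv).toEquiv.subsingleton_congr.not

theorem isGrade_quotSMulTop_iff {r : R} (hN : r ∈ Module.annihilator R N)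
    (hM : IsSMulRegular M r) : IsGrade R N (QuotSMulTop r M) d ↔ IsGrade R N M (d + 1) := by
  simp only [IsGrade, subsingleton_ext_quotSMulTop_iff hN hM, Nat.forall_lt_succ_left]
  have h₀ := subsingleton_ext_zero_of_isSMulRegular hN hM
  constructor
  · rintro ⟨vanishing, nonvanishing⟩
    refine ⟨⟨h₀, fun i hi => (vanishing i hi).2⟩, fun h => nonvanishing ⟨?_, h⟩⟩
    cases d with
    | zero => exact h₀
    | succ d => exact (vanishing d d.lt_succ_self).2
  · rintro ⟨⟨-, vanishing⟩, nonvanishing⟩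
    refine ⟨fun i hi => ⟨?_, vanishing i hi⟩, fun h => nonvanishing h.2⟩
    cases i with
    | zero => exact h₀
    | succ i => exact vanishing i (i.lt_succ_self.trans hi)

theorem isGrade_succ_of_exact {A B C : Type v} [AddCommGroup A] [Module R A] [AddCommGroup B]
    [Module R B] [AddCommGroup C] [Module R C] {f : A →ₗ[R] B} {g : B →ₗ[R] C}
    (hfg : Function.Exact f g) (hf : Function.Injective f) (hg : Function.Surjective g)
    (hB : ∀ i ≤ d, Subsingleton (Ext (ModuleCat.of R N) (ModuleCat.of R B) i))
    (hC : IsGrade R N C d) : IsGrade R N A (d + 1) := by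
  have hS := ModuleCat.shortComplex_shortExact
    (ModuleCat.shortComplexOfCompEqZero f g hfg.linearMap_comp_eq_zero) hfg hf hg
  refine ⟨fun i hi => ?_, fun hA =>
    hC.2 (subsingleton_ext_right_of_shortExact hS _ (hB d le_rfl) hA)⟩
  cases i with
  | zero =>
    have := hB 0 d.zero_le
    exact subsingleton_ext_zero_left_of_shortExact hS _
  | succ i => exact subsingleton_ext_succ_left_of_shortExact hS _ (hC.1 i (by lia)) (hB _ (by lia))

theorem isGrade_quotient_inf {P Q : Submodule R M} {e p q : ℕ} (hsup : IsGrade R N (M ⧸ P ⊔ Q) e)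
    (hP : IsGrade R N (M ⧸ P) p) (hQ : IsGrade R N (M ⧸ Q) q) (hep : e < p) (heq : e < q) :
    IsGrade R N (M ⧸ P ⊓ Q) (e + 1) :=
  isGrade_succ_of_exact (exact_quotientInfToProd_prodToQuotientSup P Q)
    (quotientInfToProd_injective P Q) (prodToQuotientSup_surjective P Q)
    (fun i hi => subsingleton_ext_prod _ (hP.1 i (hi.trans_lt hep)) (hQ.1 i (hi.trans_lt heq))) hsup

end Grade

end Ext

section Rees

open scoped Pointwise

universe u

variable {R : Type u} [CommRing R] {I J : Ideal R} {d : ℕ}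

variable (I J) in
theorem smul_top_quotient : J • (⊤ : Submodule R (R ⧸ I)) = Submodule.map I.mkQ J := by
  rw [← Submodule.range_mkQ I, ← Submodule.map_top, ← Submodule.map_smul'', smul_eq_mul,
    Ideal.mul_top]

theorem isGrade_quotient_sup_span_singleton_iff {r : R} (hr : r ∈ J)
    (regular : ∀ x, r * x ∈ I → x ∈ I) :
    IsGrade R (R ⧸ J) (R ⧸ I ⊔ Ideal.span {r}) d ↔ IsGrade R (R ⧸ J) (R ⧸ I) (d + 1) := by
  have hM : IsSMulRegular (R ⧸ I) r :=
    (isSMulRegular_quotient_iff_mem_of_smul_mem I r).2 regular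
  have hN : r ∈ Module.annihilator R (R ⧸ J) := by rwa [Ideal.annihilator_quotient]
  have map_span : Submodule.map I.mkQ (Ideal.span {r}) = r • (⊤ : Submodule R (R ⧸ I)) := by
    rw [← smul_top_quotient, Submodule.ideal_span_singleton_smul]
  rw [← isGrade_quotSMulTop_iff hN hM]
  exact isGrade_congr ((Submodule.quotEquivOfEq _ _ map_span.symm).trans
    (Submodule.quotientQuotientEquivQuotientSup I (Ideal.span {r}))).symm

theorem isGrade_quotient_self_zero (hJ : J ≠ ⊤) : IsGrade R (R ⧸ J) (R ⧸ J) 0 := by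
  have := Ideal.Quotient.nontrivial_iff.2 hJ
  exact isGrade_zero_iff.2 (inferInstanceAs (Nontrivial (Module.End R (R ⧸ J))))

theorem moduleDepth_eq_of_isGrade [IsNoetherianRing R] {M : Type u} [AddCommGroup M] [Module R M]
    [Module.Finite R M] (hM : J • (⊤ : Submodule R M) ≠ ⊤) (hd : IsGrade R (R ⧸ J) M d) :
    moduleDepth J M = d := by
  have hJ : J ≠ ⊤ := by
    rintro rfl
    exact hM (Submodule.top_smul _)
  have := Ideal.Quotient.nontrivial_iff.2 hJ
  have support_eq : Module.support R (R ⧸ J) = PrimeSpectrum.zeroLocus J := by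
    rw [Module.support_eq_zeroLocus, Ideal.annihilator_quotient]
  refine le_antisymm (iSup₂_le fun rs hrs => ?_) ?_
  · refine Nat.cast_le.2 (le_of_not_gt fun hlt => hd.2 ?_)
    exact ModuleCat.subsingleton_ext_of_exists_isRegular J (ModuleCat.of R (R ⧸ J))
      support_eq.subset (ModuleCat.of R M) hM.lt_top rs hrs.1 hrs.2 d hlt
  · obtain ⟨rs, length_eq, hrs⟩ := ModuleCat.exists_isRegular_of_exists_subsingleton_ext J d
      (ModuleCat.of R M) hM.lt_top (ModuleCat.of R (R ⧸ J)) support_eq hd.1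
    exact le_iSup₂_of_le rs hrs (by rw [length_eq])

theorem smul_top_quotient_ne_top (hIJ : I ≤ J) (hJ : J ≠ ⊤) :
    J • (⊤ : Submodule R (R ⧸ I)) ≠ ⊤ := by
  rw [smul_top_quotient, Ne, Submodule.map_mkQ_eq_top, sup_eq_right.2 hIJ]
  exact hJ

end Rees

section Primes

variable {R ι : Type*} [CommRing R] {p : ι → Ideal R}

theorem mem_minimalPrimes_iInf [Finite ι] (prime : ∀ i, (p i).IsPrime)
    (hp : ∀ i j, p i ≤ p j → i = j) (i : ι) : p i ∈ (⨅ j, p j).minimalPrimes := by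
  refine ⟨⟨prime i, iInf_le p i⟩, fun q hq hqi => ?_⟩
  have := Fintype.ofFinite ι
  obtain ⟨j, -, hj⟩ := hq.1.inf_le'.1 ((Finset.inf_univ_eq_iInf p).trans_le hq.2)
  exact hp j i (hj.trans hqi) ▸ hj

theorem associatedPrimes_quotient_iInf_subset [IsNoetherianRing R] [Finite ι]
    (prime : ∀ i, (p i).IsPrime) : associatedPrimes R (R ⧸ ⨅ i, p i) ⊆ Set.range p := by
  have := Fintype.ofFinite ι
  rw [← Finset.inf_univ_eq_iInf]
  induction (Finset.univ : Finset ι) using Finset.cons_induction with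
  | empty =>
    have : Subsingleton (R ⧸ (⊤ : Ideal R)) := Ideal.Quotient.subsingleton_iff.2 rfl
    exact (associatedPrimes.eq_empty_of_subsingleton (M := R ⧸ (⊤ : Ideal R))).trans_subset
      (Set.empty_subset _)
  | cons i s his ih =>
    rw [Finset.inf_cons]
    have := quotientInfToProd_injective (p i) (s.inf p)
    refine (associatedPrimes.subset_of_injective this).trans ?_
    rw [associatedPrimes.prod, associatedPrimes.eq_singleton_of_isPrimary (prime i).isPrimary,
      (prime i).radical]
    exact Set.union_subset (Set.singleton_subset_iff.2 ⟨i, rfl⟩) ih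

theorem associatedPrimes_quotient_iInf [IsNoetherianRing R] [Finite ι]
    (prime : ∀ i, (p i).IsPrime) (hp : ∀ i j, p i ≤ p j → i = j) :
    associatedPrimes R (R ⧸ ⨅ i, p i) = Set.range p := by
  refine (associatedPrimes_quotient_iInf_subset prime).antisymm ?_
  rintro _ ⟨i, rfl⟩
  refine Module.associatedPrimes.minimalPrimes_annihilator_subset_associatedPrimes R
    (R ⧸ ⨅ i, p i) ?_
  rw [Ideal.annihilator_quotient]
  exact mem_minimalPrimes_iInf prime hp i

theorem moduleMDepth_quotient_iInf [IsNoetherianRing R] [Finite ι]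
    (prime : ∀ i, (p i).IsPrime) (hp : ∀ i j, p i ≤ p j → i = j) :
    moduleMDepth R (R ⧸ ⨅ i, p i) = ⨅ i, ringKrullDim (R ⧸ p i) := by
  rw [moduleMDepth, associatedPrimes_quotient_iInf prime hp, iInf_range]

theorem exists_eq_of_iInf_eq_prod [Finite ι] {κ : Type*} [Fintype κ] {q : κ → Ideal R}
    (prime_p : ∀ i, (p i).IsPrime) (hp : ∀ i j, p i ≤ p j → i = j)
    (prime_q : ∀ j, (q j).IsPrime) (h : ⨅ i, p i = ∏ j, q j) (i : ι) : ∃ j, q j = p i := by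
  have prod_le : ∏ j, q j ≤ p i := h ▸ iInf_le p i
  obtain ⟨j, -, hj⟩ := (prime_p i).prod_le.1 prod_le
  have iInf_le_q : ⨅ i, p i ≤ q j :=
    h ▸ Ideal.prod_le_inf.trans (Finset.inf_le (Finset.mem_univ j))
  exact ⟨j, hj.antisymm ((mem_minimalPrimes_iInf prime_p hp i).2 ⟨prime_q j, iInf_le_q⟩ hj)⟩

end Primes

section VarIdeal

open MvPolynomial

/-- The ideal generated by the variables `X i` with `i ∈ F`. -/
noncomputable def varIdeal (R : Type*) {σ : Type*} [CommSemiring R] (F : Set σ) :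
    Ideal (MvPolynomial σ R) :=
  Ideal.span (X '' F)

section CommSemiring

variable {R σ : Type*} [CommSemiring R] {F G : Set σ}

theorem X_mem_varIdeal {i : σ} (hi : i ∈ F) : X i ∈ varIdeal R F :=
  Ideal.subset_span ⟨i, hi, rfl⟩

theorem varIdeal_mono (h : F ⊆ G) : varIdeal R F ≤ varIdeal R G :=
  Ideal.span_mono (Set.image_mono h)

theorem varIdeal_union : varIdeal R (F ∪ G) = varIdeal R F ⊔ varIdeal R G := by
  simp only [varIdeal, Set.image_union, Ideal.span_union]

theorem varIdeal_empty : varIdeal R (∅ : Set σ) = ⊥ := by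
  rw [varIdeal, Set.image_empty, Ideal.span_empty]

theorem varIdeal_singleton (i : σ) : varIdeal R {i} = Ideal.span {X i} := by
  rw [varIdeal, Set.image_singleton]

section Nontrivial

variable [Nontrivial R]

theorem X_mem_varIdeal_iff {i : σ} : X i ∈ varIdeal R F ↔ i ∈ F := by
  refine ⟨fun h => ?_, X_mem_varIdeal⟩
  obtain ⟨j, hj, hij⟩ := mem_ideal_span_X_image.1 h (Finsupp.single i 1) (by simp)
  rwa [← (Finsupp.single_apply_ne_zero.1 hij).1]

theorem varIdeal_le_varIdeal_iff : varIdeal R F ≤ varIdeal R G ↔ F ⊆ G :=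
  ⟨fun h _ hi => X_mem_varIdeal_iff.1 (h (X_mem_varIdeal hi)), varIdeal_mono⟩

theorem varIdeal_injective : Function.Injective (varIdeal R : Set σ → _) := fun _ _ h =>
  (varIdeal_le_varIdeal_iff.1 h.le).antisymm (varIdeal_le_varIdeal_iff.1 h.ge)

end Nontrivial

end CommSemiring

variable {R σ : Type*} [CommRing R] {F : Set σ}

theorem varIdeal_univ : varIdeal R (Set.univ : Set σ) = idealOfVars σ R := by
  rw [varIdeal, Set.image_univ, idealOfVars]

theorem ker_killCompl_val :
    RingHom.ker (killCompl (R := R) (Subtype.val_injective : Function.Injective ((↑) : ↥Fᶜ → σ))) =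
      varIdeal R F := by
  refine le_antisymm (fun u hu => ?_) (Ideal.span_le.2 ?_)
  · refine mem_ideal_span_X_image.2 fun m hm => ?_
    by_contra! vanish_on_F
    have range_val : (m.support : Set σ) ⊆ Set.range (Subtype.val : ↥Fᶜ → σ) := by
      rw [Subtype.range_coe]
      exact fun i hi hF => Finsupp.mem_support_iff.1 hi (vanish_on_F i hF)
    refine mem_support_iff.1 hm ?_
    rw [← m.mapDomain_comapDomain _ Subtype.val_injective range_val,
      ← coeff_killCompl Subtype.val_injective]
    exact congrArg (coeff _) hu
  · rintro _ ⟨i, hi, rfl⟩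
    simp [killCompl, show i ∈ F from hi]

/-- Setting the variables in `F` to zero identifies the quotient by `varIdeal R F` with the
polynomial ring in the remaining variables. -/
noncomputable def quotientVarIdealEquiv (R : Type*) {σ : Type*} [CommRing R] (F : Set σ) :
    (MvPolynomial σ R ⧸ varIdeal R F) ≃+* MvPolynomial ↥Fᶜ R :=
  (Ideal.quotEquivOfEq ker_killCompl_val.symm).trans
    (RingHom.quotientKerEquivOfSurjective
      (Function.LeftInverse.surjective (killCompl_rename_app Subtype.val_injective)))

theorem varIdeal_ne_top [Nontrivial R] : varIdeal R F ≠ ⊤ :=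
  Ideal.Quotient.nontrivial_iff.1 (quotientVarIdealEquiv R F).nontrivial

theorem idealOfVars_ne_top [Nontrivial R] : idealOfVars σ R ≠ ⊤ :=
  varIdeal_univ (R := R) (σ := σ) ▸ varIdeal_ne_top

theorem isPrime_varIdeal [IsDomain R] : (varIdeal R F).IsPrime := by
  have := (quotientVarIdealEquiv R F).toMulEquiv.isDomain
  exact (Ideal.Quotient.isDomain_iff_prime _).1 ‹_›

theorem ringKrullDim_quotient_varIdeal [IsNoetherianRing R] [Finite σ] :
    ringKrullDim (MvPolynomial σ R ⧸ varIdeal R F) = ringKrullDim R + Fᶜ.ncard := by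
  rw [ringKrullDim_eq_of_ringEquiv (quotientVarIdealEquiv R F),
    MvPolynomial.ringKrullDim_of_isNoetherianRing, Nat.card_coe_set_eq]

theorem isPrincipal_varIdeal_iff [IsDomain R] : (varIdeal R F).IsPrincipal ↔ F.Subsingleton := by
  constructor
  · rintro ⟨u, hu⟩ i hi j hj
    have hu : varIdeal R F = Ideal.span {u} := hu
    have not_isUnit : ¬ IsUnit u := fun h =>
      varIdeal_ne_top (hu.trans (Ideal.span_singleton_eq_top.2 h))
    have dvd_X : u ∣ X i := Ideal.mem_span_singleton.1 (hu ▸ X_mem_varIdeal hi)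
    have span_eq : varIdeal R F = varIdeal R {i} := by
      rw [hu, varIdeal_singleton, Ideal.span_singleton_eq_span_singleton]
      exact ((X_prime.irreducible.dvd_iff.1 dvd_X).resolve_left not_isUnit).symm
    have F_eq : F = {i} := varIdeal_injective span_eq
    rw [F_eq] at hj
    exact hj.symm
  · intro h
    obtain rfl | ⟨i, rfl⟩ := h.eq_empty_or_singleton
    · exact varIdeal_empty (R := R) (σ := σ) ▸ bot_isPrincipal
    · exact ⟨X i, varIdeal_singleton i⟩

end VarIdeal

section MonomialIdeals

open MvPolynomial

/-- `J` is generated by monomials which only involve variables indexed by `W`. -/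
def IsMonomialOn {σ R : Type*} [CommSemiring R] (W : Set σ) (J : Ideal (MvPolynomial σ R)) :
    Prop :=
  ∃ s : Set (σ →₀ ℕ), (∀ e ∈ s, ∀ v ∉ W, e v = 0) ∧
    J = Ideal.span ((fun e => monomial e (1 : R)) '' s)

namespace IsMonomialOn

variable {σ R : Type*} [CommSemiring R] {W W' : Set σ} {J J' : Ideal (MvPolynomial σ R)}

theorem mono (h : IsMonomialOn W J) (hW : W ⊆ W') : IsMonomialOn W' J :=
  let ⟨s, hs, hJ⟩ := h
  ⟨s, fun e he v hv => hs e he v fun hvW => hv (hW hvW), hJ⟩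

theorem one : IsMonomialOn W (1 : Ideal (MvPolynomial σ R)) :=
  ⟨{0}, by simp, by simp [Ideal.span_singleton_one, Ideal.one_eq_top]⟩

theorem sup (h : IsMonomialOn W J) (h' : IsMonomialOn W J') : IsMonomialOn W (J ⊔ J') := by
  obtain ⟨s, hs, rfl⟩ := h
  obtain ⟨t, ht, rfl⟩ := h'
  exact ⟨s ∪ t, fun e he => he.elim (hs e) (ht e), by rw [Set.image_union, Ideal.span_union]⟩

theorem mul (h : IsMonomialOn W J) (h' : IsMonomialOn W J') : IsMonomialOn W (J * J') := by
  obtain ⟨s, hs, rfl⟩ := h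
  obtain ⟨t, ht, rfl⟩ := h'
  refine ⟨Set.image2 (· + ·) s t, ?_, ?_⟩
  · rintro _ ⟨e, he, f, hf, rfl⟩ v hv
    simp [hs e he v hv, ht f hf v hv]
  · rw [Ideal.span_mul_span', ← Set.image2_mul, Set.image2_image_left, Set.image2_image_right,
      Set.image_image2]
    simp only [monomial_mul, one_mul]

theorem prod {ι : Type*} {s : Finset ι} {f : ι → Ideal (MvPolynomial σ R)}
    (h : ∀ i ∈ s, IsMonomialOn W (f i)) : IsMonomialOn W (∏ i ∈ s, f i) :=
  Finset.prod_induction f (IsMonomialOn W) (fun _ _ => mul) one h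

theorem X_mul_mem (h : IsMonomialOn W J) {a : σ} (ha : a ∉ W) {u : MvPolynomial σ R}
    (hu : X a * u ∈ J) : u ∈ J := by
  obtain ⟨s, hs, rfl⟩ := h
  rw [mem_ideal_span_monomial_image] at hu ⊢
  intro m hm
  obtain ⟨e, he, e_le⟩ := hu (Finsupp.single a 1 + m) (by
    rwa [mem_support_iff, coeff_X_mul, ← mem_support_iff])
  refine ⟨e, he, fun v => ?_⟩
  obtain rfl | hv := eq_or_ne v a
  · simp [hs e he v ha]
  · simpa [Finsupp.single_eq_of_ne hv] using e_le v

theorem inf_eq_mul (h : IsMonomialOn W J) (h' : IsMonomialOn W' J') (hW : Disjoint W W') :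
    J ⊓ J' = J * J' := by
  refine le_antisymm ?_ Ideal.mul_le_inf
  obtain ⟨s, hs, rfl⟩ := h
  obtain ⟨t, ht, rfl⟩ := h'
  rintro u ⟨hu, hu'⟩
  rw [SetLike.mem_coe, mem_ideal_span_monomial_image] at hu hu'
  rw [u.as_sum]
  refine Ideal.sum_mem _ fun m hm => ?_
  obtain ⟨e, he, e_le⟩ := hu m hm
  obtain ⟨f, hf, f_le⟩ := hu' m hm
  have add_le : e + f ≤ m := by
    intro v
    by_cases hv : v ∈ W
    · simpa [ht f hf v (Set.disjoint_left.1 hW hv)] using e_le v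
    · simpa [hs e he v hv] using f_le v
  have factorization : monomial m (coeff m u) =
      monomial (m - (e + f)) (coeff m u) * (monomial e 1 * monomial f 1) := by
    simp only [monomial_mul, mul_one, tsub_add_cancel_of_le add_le]
  rw [factorization]
  exact Ideal.mul_mem_left _ _ (Ideal.mul_mem_mul (Ideal.subset_span ⟨e, he, rfl⟩)
    (Ideal.subset_span ⟨f, hf, rfl⟩))

end IsMonomialOn

theorem isMonomialOn_varIdeal {σ R : Type*} [CommSemiring R] (W : Set σ) :
    IsMonomialOn W (varIdeal R W) := by
  refine ⟨(fun i => Finsupp.single i 1) '' W, ?_, by rw [Set.image_image]; rfl⟩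
  rintro _ ⟨i, hi, rfl⟩ v hv
  exact Finsupp.single_eq_of_ne fun h => hv (h ▸ hi)

section DisjointVariables

variable {ι σ R : Type*} [CommSemiring R] {F : ι → Set σ} {s : Finset ι}

theorem isMonomialOn_compl_prod_varIdeal {G : Set σ} (hG : ∀ i ∈ s, Disjoint (F i) G) :
    IsMonomialOn Gᶜ (∏ i ∈ s, varIdeal R (F i)) :=
  .prod fun i hi => (isMonomialOn_varIdeal (F i)).mono
    (Set.subset_compl_iff_disjoint_right.2 (hG i hi))

theorem prod_varIdeal_eq_inf (hF : (s : Set ι).PairwiseDisjoint F) :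
    ∏ j ∈ s, varIdeal R (F j) = s.inf fun j => varIdeal R (F j) := by
  induction s using Finset.cons_induction with
  | empty => simp
  | cons i s his ih =>
    rw [Finset.coe_cons, Set.pairwiseDisjoint_insert_of_notMem his] at hF
    rw [Finset.prod_cons, Finset.inf_cons, ← ih hF.1, mul_comm, inf_comm]
    exact ((isMonomialOn_compl_prod_varIdeal fun j hj => (hF.2 j hj).symm).inf_eq_mul
      (isMonomialOn_varIdeal _) disjoint_compl_left).symm

theorem prod_varIdeal_eq_iInf [Fintype ι] (hF : Pairwise (Function.onFun Disjoint F)) :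
    ∏ j, varIdeal R (F j) = ⨅ j, varIdeal R (F j) := by
  rw [prod_varIdeal_eq_inf (hF.set_pairwise _), Finset.inf_univ_eq_iInf]

end DisjointVariables

end MonomialIdeals

section Depth

open MvPolynomial

theorem card_add_ncard_compl {σ : Type*} [Finite σ] (A : Finset σ) :
    A.card + (A : Set σ)ᶜ.ncard = Nat.card σ := by
  rw [← Set.ncard_coe_finset, Set.ncard_add_ncard_compl]

theorem sum_card_le_card_of_pairwiseDisjoint {ι σ : Type*} [Finite σ] {F : ι → Finset σ}
    {s : Finset ι} (hF : (s : Set ι).PairwiseDisjoint F) :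
    ∑ i ∈ s, (F i).card ≤ Nat.card σ := by
  have := Fintype.ofFinite σ
  rw [← Finset.card_disjiUnion s F hF, Nat.card_eq_fintype_card]
  exact Finset.card_le_univ _

section Grade

variable {R σ ι : Type*} [CommRing R]

theorem isGrade_quotient_sup_varIdeal_iff {W : Set σ} {I : Ideal (MvPolynomial σ R)}
    (hI : IsMonomialOn W I) {A : Finset σ} (hA : Disjoint W A) {d : ℕ} :
    IsGrade (MvPolynomial σ R) (MvPolynomial σ R ⧸ idealOfVars σ R)
        (MvPolynomial σ R ⧸ I ⊔ varIdeal R A) d ↔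
      IsGrade (MvPolynomial σ R) (MvPolynomial σ R ⧸ idealOfVars σ R)
        (MvPolynomial σ R ⧸ I) (d + A.card) := by
  induction A using Finset.cons_induction generalizing d with
  | empty => rw [Finset.coe_empty, varIdeal_empty, sup_bot_eq, Finset.card_empty, add_zero]
  | cons a A ha ih =>
    rw [Finset.coe_cons, Set.disjoint_insert_right] at hA
    have monomialOn_sup : IsMonomialOn (W ∪ A) (I ⊔ varIdeal R A) :=
      (hI.mono Set.subset_union_left).sup
        ((isMonomialOn_varIdeal _).mono Set.subset_union_right)
    have X_regular (u : MvPolynomial σ R) (hu : X a * u ∈ I ⊔ varIdeal R A) :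
        u ∈ I ⊔ varIdeal R A :=
      monomialOn_sup.X_mul_mem (not_or.2 ⟨hA.1, ha⟩) hu
    have X_mem : X a ∈ idealOfVars σ R := Ideal.subset_span ⟨a, rfl⟩
    rw [Finset.coe_cons, Set.insert_eq, Set.union_comm, varIdeal_union, varIdeal_singleton,
      ← sup_assoc, isGrade_quotient_sup_span_singleton_iff X_mem X_regular, ih hA.2,
      Finset.card_cons, add_right_comm, add_assoc]

variable [Nontrivial R] [Finite σ]

theorem isGrade_quotient_varIdeal (F : Set σ) :
    IsGrade (MvPolynomial σ R) (MvPolynomial σ R ⧸ idealOfVars σ R)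
      (MvPolynomial σ R ⧸ varIdeal R F) Fᶜ.ncard := by
  have hF := Fᶜ.toFinite
  have grade_zero := isGrade_quotient_self_zero (idealOfVars_ne_top (R := R) (σ := σ))
  have sup_eq : varIdeal R F ⊔ varIdeal R ↑hF.toFinset = idealOfVars σ R := by
    rw [← varIdeal_union, hF.coe_toFinset, Set.union_compl_self, varIdeal_univ]
  rw [Set.ncard_eq_toFinset_card _ hF, ← Nat.zero_add hF.toFinset.card,
    ← isGrade_quotient_sup_varIdeal_iff (isMonomialOn_varIdeal F), sup_eq]
  · exact grade_zero
  · rw [hF.coe_toFinset]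
    exact disjoint_compl_right

theorem isGrade_quotient_mul_varIdeal {W : Set σ} {I : Ideal (MvPolynomial σ R)}
    (hI : IsMonomialOn W I) {F : Finset σ} (hF : F.Nonempty) (hW : Disjoint W F) {d : ℕ}
    (hd : d < (F : Set σ)ᶜ.ncard)
    (grade : IsGrade (MvPolynomial σ R) (MvPolynomial σ R ⧸ idealOfVars σ R)
      (MvPolynomial σ R ⧸ I) (d + F.card)) :
    IsGrade (MvPolynomial σ R) (MvPolynomial σ R ⧸ idealOfVars σ R)
      (MvPolynomial σ R ⧸ I * varIdeal R F) (d + 1) := by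
  rw [← hI.inf_eq_mul (isMonomialOn_varIdeal _) hW]
  exact isGrade_quotient_inf ((isGrade_quotient_sup_varIdeal_iff hI hW).2 grade) grade
    (isGrade_quotient_varIdeal _) (Nat.lt_add_of_pos_right hF.card_pos) hd

theorem isGrade_quotient_prod_varIdeal {F : ι → Finset σ} {s : Finset ι} (hs : s.Nonempty)
    (hF : ∀ i ∈ s, (F i).Nonempty) (disjoint : (s : Set ι).PairwiseDisjoint F) {d : ℕ}
    (hd : d + ∑ i ∈ s, (F i).card + 1 = Nat.card σ + s.card) :
    IsGrade (MvPolynomial σ R) (MvPolynomial σ R ⧸ idealOfVars σ R)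
      (MvPolynomial σ R ⧸ ∏ i ∈ s, varIdeal R (F i : Set σ)) d := by
  induction hs using Finset.Nonempty.cons_induction generalizing d with
  | singleton i =>
    rw [Finset.sum_singleton, Finset.card_singleton] at hd
    have d_eq : d = (F i : Set σ)ᶜ.ncard := by have := card_add_ncard_compl (F i); lia
    rw [Finset.prod_singleton, d_eq]
    exact isGrade_quotient_varIdeal _
  | cons i s his hs ih =>
    rw [Finset.forall_mem_cons] at hF
    have sum_le := sum_card_le_card_of_pairwiseDisjoint disjoint
    rw [Finset.sum_cons] at hd sum_le
    rw [Finset.card_cons] at hd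
    rw [Finset.coe_cons, Set.pairwiseDisjoint_insert_of_notMem his] at disjoint
    have card_le : s.card ≤ ∑ j ∈ s, (F j).card :=
      s.card_eq_sum_ones.trans_le (Finset.sum_le_sum fun j hj => (hF.2 j hj).card_pos)
    have monomialOn_prod : IsMonomialOn (F i : Set σ)ᶜ (∏ j ∈ s, varIdeal R (F j : Set σ)) :=
      isMonomialOn_compl_prod_varIdeal fun j hj => Finset.disjoint_coe.2 (disjoint.2 j hj).symm
    obtain ⟨e, rfl⟩ : ∃ e, d = e + 1 := ⟨d - 1, by have := hs.card_pos; lia⟩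
    rw [Finset.prod_cons, mul_comm]
    exact isGrade_quotient_mul_varIdeal monomialOn_prod hF.1 disjoint_compl_left
      (by have := card_add_ncard_compl (F i); have := hs.card_pos; lia)
      (ih hF.2 disjoint.1 (by lia))

end Grade

theorem sum_add_one_eq_iff {ι : Type*} [Fintype ι] {a : ι → ℕ} (pos : ∀ i, 1 ≤ a i) {m : ι}
    (hm : ∀ i, a i ≤ a m) :
    ∑ i, a i + 1 = a m + Fintype.card ι ↔ ∀ i j, 1 < a i → 1 < a j → i = j := by
  classical
  have sum_ones_eq_iff :
      ∑ i ∈ Finset.univ.erase m, 1 = ∑ i ∈ Finset.univ.erase m, a i ↔ ∀ i ≠ m, 1 = a i := by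
    rw [Finset.sum_eq_sum_iff_of_le fun i _ => pos i]
    simp only [Finset.mem_erase, Finset.mem_univ, and_true]
  have sum_eq := Finset.add_sum_erase Finset.univ a (Finset.mem_univ m)
  have card_eq := Finset.card_erase_add_one (Finset.mem_univ m)
  rw [← Finset.card_eq_sum_ones] at sum_ones_eq_iff
  rw [Finset.card_univ] at card_eq
  rw [← sum_eq, ← card_eq, add_assoc, Nat.add_left_cancel_iff, Nat.add_right_cancel_iff, eq_comm,
    sum_ones_eq_iff]
  refine ⟨fun h i j hi hj => ?_, fun h i hi => ?_⟩
  · have eq_m (k : ι) (hk : 1 < a k) : k = m := not_imp_comm.1 (h k) hk.ne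
    rw [eq_m i hi, eq_m j hj]
  · by_contra hne
    have lt : 1 < a i := (pos i).lt_of_ne hne
    exact hi (h i m lt (lt.trans_le (hm i)))

theorem moduleMDepth_quotient_iInf_varIdeal {R σ ι : Type*} [CommRing R] [IsDomain R]
    [IsNoetherianRing R] [Finite σ] [Finite ι] {F : ι → Set σ}
    (hF : ∀ i j, F i ⊆ F j → i = j) :
    moduleMDepth (MvPolynomial σ R) (MvPolynomial σ R ⧸ ⨅ i, varIdeal R (F i)) =
      ⨅ i, (ringKrullDim R + (F i)ᶜ.ncard) := by
  rw [moduleMDepth_quotient_iInf (fun _ => isPrime_varIdeal)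
    fun i j h => hF i j (varIdeal_le_varIdeal_iff.1 h)]
  simp only [ringKrullDim_quotient_varIdeal]

theorem moduleDepth_quotient_iInf_varIdeal {R σ ι : Type*} [CommRing R] [Nontrivial R]
    [IsNoetherianRing R] [Finite σ] [Fintype ι] [Nonempty ι] {F : ι → Finset σ}
    (hF : ∀ i, (F i).Nonempty) (disjoint : Pairwise (Function.onFun Disjoint F)) {d : ℕ}
    (hd : d + ∑ i, (F i).card + 1 = Nat.card σ + Fintype.card ι) :
    moduleDepth (idealOfVars σ R) (MvPolynomial σ R ⧸ ⨅ i, varIdeal R (F i : Set σ)) = d := by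
  have grade := isGrade_quotient_prod_varIdeal (R := R) Finset.univ_nonempty
    (fun i _ => hF i) (disjoint.set_pairwise _) hd
  rw [prod_varIdeal_eq_iInf (R := R) (F := fun i => (F i : Set σ)) fun i j hij =>
    Finset.disjoint_coe.2 (disjoint hij)] at grade
  have iInf_le : ⨅ i, varIdeal R (F i : Set σ) ≤ idealOfVars σ R := by
    rw [← varIdeal_univ]
    exact (iInf_le _ (Classical.arbitrary ι)).trans (varIdeal_mono (Set.subset_univ _))
  exact moduleDepth_eq_of_isGrade (smul_top_quotient_ne_top iInf_le idealOfVars_ne_top) grade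

theorem eq_of_subset_of_pairwise_disjoint {σ ι : Type*} {F : ι → Finset σ}
    (hF : ∀ i, (F i).Nonempty) (disjoint : Pairwise (Function.onFun Disjoint F)) (i j : ι)
    (h : F i ⊆ F j) : i = j :=
  disjoint.eq fun hij => (hF i).ne_empty (hij.eq_bot_of_le h)

theorem moduleDepth_eq_moduleMDepth_iff {K σ ι : Type*} [Field K] [Finite σ] [Finite ι]
    [Nonempty ι] {F : ι → Finset σ} (hF : ∀ i, (F i).Nonempty)
    (disjoint : Pairwise (Function.onFun Disjoint F)) :
    (moduleDepth (idealOfVars σ K) (MvPolynomial σ K ⧸ ⨅ i, varIdeal K (F i : Set σ)) :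
        WithBot ℕ∞) =
      moduleMDepth (MvPolynomial σ K) (MvPolynomial σ K ⧸ ⨅ i, varIdeal K (F i : Set σ)) ↔
    ∀ i j, (F i).Nontrivial → (F j).Nontrivial → i = j := by
  have := Fintype.ofFinite ι
  obtain ⟨m, hm⟩ := Finite.exists_max fun i => (F i).card
  have mdepth_eq :
      moduleMDepth (MvPolynomial σ K) (MvPolynomial σ K ⧸ ⨅ i, varIdeal K (F i : Set σ)) =
        (F m : Set σ)ᶜ.ncard := by
    have compl_le (i : ι) : (F m : Set σ)ᶜ.ncard ≤ (F i : Set σ)ᶜ.ncard := by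
      have := card_add_ncard_compl (F i); have := card_add_ncard_compl (F m); have := hm i; lia
    rw [moduleMDepth_quotient_iInf_varIdeal (eq_of_subset_of_pairwise_disjoint hF disjoint)]
    simp only [ringKrullDim_eq_zero_of_field, zero_add]
    exact le_antisymm (iInf_le _ m) (le_iInf fun i => mod_cast compl_le i)
  obtain ⟨d, hd⟩ : ∃ d, d + ∑ i, (F i).card + 1 = Nat.card σ + Fintype.card ι := by
    have sum_le := sum_card_le_card_of_pairwiseDisjoint (s := Finset.univ)
      (disjoint.set_pairwise _)
    have card_pos := Fintype.card_pos (α := ι)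
    exact ⟨Nat.card σ + Fintype.card ι - (∑ i, (F i).card + 1), by lia⟩
  rw [moduleDepth_quotient_iInf_varIdeal hF disjoint hd, mdepth_eq]
  simp only [← Finset.one_lt_card_iff_nontrivial]
  rw [← sum_add_one_eq_iff (fun i => (hF i).card_pos) hm]
  have := card_add_ncard_compl (F m)
  norm_cast
  lia

end Depth

theorem mainTheorem9 {K : Type*} [Field K] (n r : ℕ) (hr : 1 ≤ r)
    (F : Fin r → Finset (Fin n)) (hF : ∀ i, (F i).Nonempty)
    (hdisj : ∀ i j, i ≠ j → Disjoint (F i) (F j))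
    (I : Ideal (MvPolynomial (Fin n) K)) (hI : I = ⨅ i, monomialPrime K (F i)) :
    HasMaximalDepth I ↔
      ∃ s : ℕ, 1 ≤ s ∧ ∃ G : Fin s → Finset (Fin n),
        (∀ j, (G j).Nonempty) ∧
        I = ∏ j, monomialPrime K (G j) ∧
        ∀ j k, ¬ (monomialPrime K (G j)).IsPrincipal →
          ¬ (monomialPrime K (G k)).IsPrincipal → j = k := by
  have : Nonempty (Fin r) := ⟨⟨0, hr⟩⟩
  have disjoint : Pairwise (Function.onFun Disjoint F) := fun i j => hdisj i j
  have antichain := eq_of_subset_of_pairwise_disjoint hF disjoint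
  have not_isPrincipal_iff (A : Finset (Fin n)) :
      ¬ (monomialPrime K A).IsPrincipal ↔ A.Nontrivial :=
    isPrincipal_varIdeal_iff.not.trans Set.not_subsingleton_iff
  simp only [not_isPrincipal_iff]
  subst hI
  refine (moduleDepth_eq_moduleMDepth_iff hF disjoint).trans ⟨fun unique => ?_, ?_⟩
  · exact ⟨r, hr, F, hF, (prod_varIdeal_eq_iInf fun i j hij =>
      Finset.disjoint_coe.2 (hdisj i j hij)).symm, unique⟩
  · rintro ⟨s, -, G, -, prod_eq, unique⟩ i j hi hj
    have factor (i : Fin r) : ∃ k, G k = F i := by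
      obtain ⟨k, hk⟩ := exists_eq_of_iInf_eq_prod (fun _ => isPrime_varIdeal)
        (fun i j h => antichain i j (varIdeal_le_varIdeal_iff.1 h))
        (fun _ => isPrime_varIdeal) prod_eq i
      exact ⟨k, Finset.coe_injective (varIdeal_injective hk)⟩
    obtain ⟨k, hk⟩ := factor i
    obtain ⟨l, hl⟩ := factor j
    have hkl : k = l := unique k l (hk ▸ hi) (hl ▸ hj)
    exact antichain i j (hk ▸ hkl ▸ hl ▸ subset_rfl)
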